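/- For real numbers $a_1,\dots,a_n$ and $1\le j\le n$, let $j\text{-}\min_{i\le n} a_i$ denote the $j$-th smallest of them, counted with multiplicity (so that $(j\text{-}\min_{i\le n} a_i)_{j=1}^n$ is the non-decreasing rearrangement of $(a_i)_{i=1}^n$). There is a universal constant $C>0$ such that the following holds. Let $1\le k<n$ be integers, let $X=(X_1,\dots,X_n)$ be a centered Gaussian random vector in $\mathbb{R}^n$ with independent coordinates (with possibly different, possibly zero, variances), let $T$ be an orthogonal transformation of $\mathbb{R}^n$, and set $Y=T(X)$. Then $$ \mathbb{E}\sum_{j=1}^k j\text{-}\min_{i\le n} X_i^2 \;\le\; C\,\mathbb{E}\sum_{j=1}^k j\text{-}\min_{i\le n} Y_i^2 , $$ both expectations being finite. -/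

import Mathlib

open MeasureTheory ProbabilityTheory

/-- The entry at (0-based) position `j` of the non-decreasing rearrangement of `a`;
that is, the `(j+1)`-th smallest element of `a`, counted with multiplicity. -/
noncomputable def jMin {n : ℕ} (a : Fin n → ℝ) (j : Fin n) : ℝ :=
  a (Tuple.sort a j)

/-- The sum of the `k` smallest elements of `a` (counted with multiplicity), for `k ≤ n`. -/
noncomputable def sumJMin {n : ℕ} (k : ℕ) (a : Fin n → ℝ) : ℝ :=
  ∑ j ∈ Finset.univ.filter (fun j : Fin n => j.val < k), jMin a j

/-! ### Sums of the smallest entries -/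

/-! Both sides are compared with `∑ i, truncVar (s i) t`, where the `s i` are the standard
deviations of the `X i` and the level `t` is chosen so that on average exactly `k` coordinates
satisfy `|X i| ≤ t`.

Lower bound for `Y`: the sum of the `k` smallest entries is at least `k * c - ∑ i, max (c - a i) 0`,
whose expectation sees only the marginals, so the dependence within `Y` is harmless. The variances
of `Y` are averages of those of `X` under the doubly stochastic matrix of squared entries of `T`. By
convexity of the positive part, `Y` may be replaced by `X`; with `c = t ^ 2` the choice of `t`
leaves exactly the truncated variances.

Upper bound for `X`: coordinates with `s i ≤ 2 * t` have variance comparable to their truncated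
variance. If there are fewer than `k` of them, the others are grouped into disjoint blocks with `∑ t
/ s i` of order one, one block per missing coordinate. By independence the smallest square in a
block has mean `O(t ^ 2)` (`integral_inf'_sq_le`), which the truncated variances again pay for. -/

lemma card_filter_val_lt {n k : ℕ} (hk : k ≤ n) :
    (Finset.univ.filter (fun j : Fin n => j.val < k)).card = k := by
  rw [Fin.card_filter_val_lt, min_eq_right hk]

/-- Since `c - max (c - x) 0 = min x c ≤ x`, summing over the `k` smallest entries and subtracting
the remaining positive parts only lowers the left side. -/
lemma le_sumJMin {n k : ℕ} (hk : k ≤ n) (a : Fin n → ℝ) (c : ℝ) :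
    k * c - ∑ i, max (c - a i) 0 ≤ sumJMin k a := by
  have h1 : ∑ i, max (c - a i) 0 = ∑ j, max (c - jMin a j) 0 :=
    (Equiv.sum_comp (Tuple.sort a) (fun i => max (c - a i) 0)).symm
  have h2 : ∑ j ∈ Finset.univ.filter (fun j : Fin n => j.val < k), max (c - jMin a j) 0
      ≤ ∑ j, max (c - jMin a j) 0 :=
    Finset.sum_le_sum_of_subset_of_nonneg (Finset.filter_subset _ _)
      fun _ _ _ => le_max_right _ _
  have h3 : (k : ℝ) * c = ∑ _j ∈ Finset.univ.filter (fun j : Fin n => j.val < k), c := by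
    rw [Finset.sum_const, card_filter_val_lt hk, nsmul_eq_mul]
  have h4 : ∑ j ∈ Finset.univ.filter (fun j : Fin n => j.val < k), (c - max (c - jMin a j) 0)
      ≤ sumJMin k a :=
    Finset.sum_le_sum fun j _ => by linarith [le_max_left (c - jMin a j) 0]
  rw [Finset.sum_sub_distrib, ← h3] at h4
  linarith

lemma monotone_jMin {n : ℕ} (a : Fin n → ℝ) : Monotone (jMin a) := Tuple.monotone_sort a

lemma sumJMin_le_sum {n : ℕ} (a : Fin n → ℝ) (K : Finset (Fin n)) :
    sumJMin K.card a ≤ ∑ i ∈ K, a i := by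
  rcases K.eq_empty_or_nonempty with rfl | hK
  · simp [sumJMin]
  have hkn : K.card ≤ n := by simpa using K.card_le_univ
  have hpos : 0 < K.card := hK.card_pos
  -- With the threshold `c` at the last selected (0-based) position, the positive parts live exactly
  -- on the smallest entries.
  set l : Fin n := ⟨K.card - 1, by omega⟩ with hl
  set c := jMin a l
  set S := Finset.univ.filter (fun j : Fin n => j.val < K.card) with hS
  have hsum : ∑ i, max (c - a i) 0 = ∑ j ∈ S, (c - jMin a j) := by
    rw [← Equiv.sum_comp (Tuple.sort a) (fun i => max (c - a i) 0),
      ← Finset.sum_subset (Finset.subset_univ S)]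
    · refine Finset.sum_congr rfl fun j hj => max_eq_left (sub_nonneg.2 ?_)
      refine monotone_jMin a (Fin.le_def.2 ?_)
      have := (Finset.mem_filter.1 hj).2
      simp only [hl]; omega
    · intro j _ hj
      refine max_eq_right (sub_nonpos.2 (monotone_jMin a (Fin.le_def.2 ?_)))
      simp only [hS, Finset.mem_filter, Finset.mem_univ, true_and, not_lt] at hj
      simp only [hl]; omega
  have h1 : ∑ i ∈ K, (c - a i) ≤ ∑ i, max (c - a i) 0 :=
    (Finset.sum_le_sum fun i _ => le_max_left _ _).trans
      (Finset.sum_le_sum_of_subset_of_nonneg (Finset.subset_univ K) fun _ _ _ => le_max_right _ _)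
  rw [hsum, Finset.sum_sub_distrib, Finset.sum_sub_distrib, Finset.sum_const, Finset.sum_const,
    hS, card_filter_val_lt hkn] at h1
  unfold sumJMin
  linarith

lemma exists_sumJMin_eq {n k : ℕ} (hk : k ≤ n) (a : Fin n → ℝ) :
    ∃ K : Finset (Fin n), K.card = k ∧ sumJMin k a = ∑ i ∈ K, a i :=
  ⟨(Finset.univ.filter (fun j : Fin n => j.val < k)).map (Tuple.sort a).toEmbedding, by
    rw [Finset.card_map, card_filter_val_lt hk], by
    rw [Finset.sum_map]; rfl⟩

lemma powersetCard_univ_nonempty {n k : ℕ} (hk : k ≤ n) :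
    (Finset.powersetCard k (Finset.univ : Finset (Fin n))).Nonempty :=
  Finset.powersetCard_nonempty.2 (by simpa using hk)

/-- As a finite minimum of linear forms, the sum is visibly continuous, hence measurable; the
sorting permutation itself is not continuous. -/
lemma sumJMin_eq_inf' {n k : ℕ} (hk : k ≤ n) (a : Fin n → ℝ) :
    sumJMin k a = (Finset.powersetCard k Finset.univ).inf' (powersetCard_univ_nonempty hk)
      (fun K => ∑ i ∈ K, a i) := by
  apply le_antisymm
  · refine Finset.le_inf' _ _ fun K hK => ?_
    obtain rfl := (Finset.mem_powersetCard.1 hK).2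
    exact sumJMin_le_sum a K
  · obtain ⟨K, hK, h⟩ := exists_sumJMin_eq hk a
    rw [h]
    exact Finset.inf'_le _ (Finset.mem_powersetCard.2 ⟨Finset.subset_univ _, hK⟩)

lemma continuous_sumJMin {n k : ℕ} (hk : k ≤ n) :
    Continuous (fun a : Fin n → ℝ => sumJMin k a) := by
  simp_rw [sumJMin_eq_inf' hk]
  exact Continuous.finset_inf'_apply _ fun K _ => by fun_prop

lemma sumJMin_nonneg {n : ℕ} (k : ℕ) {a : Fin n → ℝ} (ha : ∀ i, 0 ≤ a i) : 0 ≤ sumJMin k a :=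
  Finset.sum_nonneg fun _ _ => ha _

lemma sumJMin_le_sum_univ {n : ℕ} (k : ℕ) {a : Fin n → ℝ} (ha : ∀ i, 0 ≤ a i) :
    sumJMin k a ≤ ∑ i, a i := by
  rw [← Equiv.sum_comp (Tuple.sort a)]
  exact Finset.sum_le_sum_of_subset_of_nonneg (Finset.filter_subset _ _) fun _ _ _ => ha _

lemma integrable_sumJMin {n k : ℕ} (hk : k ≤ n) {Ω : Type*} [MeasurableSpace Ω] {P : Measure Ω}
    {a : Fin n → Ω → ℝ} (ha : ∀ i ω, 0 ≤ a i ω) (hint : ∀ i, Integrable (a i) P) :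
    Integrable (fun ω => sumJMin k (fun i => a i ω)) P := by
  refine (integrable_finsetSum Finset.univ fun i _ => hint i).mono'
    ((continuous_sumJMin hk).measurable.comp_aemeasurable
      (aemeasurable_pi_lambda _ fun i => (hint i).aemeasurable)).aestronglyMeasurable ?_
  refine Filter.Eventually.of_forall fun ω => ?_
  rw [Real.norm_of_nonneg (sumJMin_nonneg k fun i => ha i ω)]
  exact sumJMin_le_sum_univ k fun i => ha i ω

/-! ### Estimates for the standard Gaussian measure -/

/-- The standard Gaussian measure of `[-x, x]`. -/
noncomputable def centralProb (x : ℝ) : ℝ := (gaussianReal 0 1).real (Set.Icc (-x) x)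

lemma gaussianPDFReal_std_le (y : ℝ) : gaussianPDFReal 0 1 y ≤ 1 / 2 := by
  have h : (2 : ℝ) ≤ √(2 * Real.pi) := Real.le_sqrt_of_sq_le (by nlinarith [Real.pi_gt_three])
  have he : Real.exp (-(y ^ 2) / 2) ≤ 1 := Real.exp_le_one_iff.2 (by nlinarith [sq_nonneg y])
  have hi : (√(2 * Real.pi))⁻¹ ≤ 1 / 2 := by
    rw [one_div]; exact inv_anti₀ (by norm_num) h
  simp only [gaussianPDFReal, NNReal.coe_one, mul_one, sub_zero]
  calc _ ≤ (1 / 2 : ℝ) * 1 := mul_le_mul hi he (Real.exp_nonneg _) (by norm_num)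
    _ = _ := mul_one _

lemma le_gaussianPDFReal_std {y : ℝ} (hy : |y| ≤ 1) : 1 / 6 ≤ gaussianPDFReal 0 1 y := by
  have h : √(2 * Real.pi) ≤ 3 := Real.sqrt_le_iff.2 ⟨by norm_num, by nlinarith [Real.pi_lt_four]⟩
  have hy2 : y ^ 2 ≤ 1 := (sq_le_one_iff_abs_le_one y).2 hy
  have he : 1 / 2 ≤ Real.exp (-(y ^ 2) / 2) := by
    linarith [Real.add_one_le_exp (-(y ^ 2) / 2)]
  have hi : 1 / 3 ≤ (√(2 * Real.pi))⁻¹ := by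
    rw [one_div]; exact inv_anti₀ (by positivity) h
  simp only [gaussianPDFReal, NNReal.coe_one, mul_one, sub_zero]
  calc (1 / 6 : ℝ) = 1 / 3 * (1 / 2) := by norm_num
    _ ≤ _ := mul_le_mul hi he (by norm_num) (by positivity)

lemma centralProb_eq_setIntegral (x : ℝ) :
    centralProb x = ∫ y in Set.Icc (-x) x, gaussianPDFReal 0 1 y := by
  rw [centralProb, measureReal_def, gaussianReal_apply_eq_integral 0 one_ne_zero,
    ENNReal.toReal_ofReal]
  exact integral_nonneg fun _ => gaussianPDFReal_nonneg _ _ _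

lemma centralProb_eq_intervalIntegral {x : ℝ} (hx : 0 ≤ x) :
    centralProb x = ∫ y in -x..x, gaussianPDFReal 0 1 y := by
  rw [centralProb_eq_setIntegral, intervalIntegral.integral_of_le (by linarith),
    integral_Icc_eq_integral_Ioc]

lemma centralProb_le_one (x : ℝ) : centralProb x ≤ 1 := measureReal_le_one

lemma centralProb_mono : Monotone centralProb := fun _ _ h =>
  measureReal_mono (Set.Icc_subset_Icc (neg_le_neg h) h)

lemma centralProb_le {x : ℝ} (hx : 0 ≤ x) : centralProb x ≤ x := by
  rw [centralProb_eq_intervalIntegral hx]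
  calc _ ≤ ∫ _ in -x..x, (1 / 2 : ℝ) :=
        intervalIntegral.integral_mono_on (by linarith)
          (integrable_gaussianPDFReal 0 1).intervalIntegrable
          intervalIntegrable_const fun y _ => gaussianPDFReal_std_le y
    _ = x := by rw [intervalIntegral.integral_const, smul_eq_mul]; ring

lemma le_centralProb {x : ℝ} (hx : 0 ≤ x) (hx1 : x ≤ 1) : x / 3 ≤ centralProb x := by
  rw [centralProb_eq_intervalIntegral hx]
  calc x / 3 = ∫ _ in -x..x, (1 / 6 : ℝ) := by
        rw [intervalIntegral.integral_const, smul_eq_mul]; ring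
    _ ≤ _ := intervalIntegral.integral_mono_on (by linarith) intervalIntegrable_const
        (integrable_gaussianPDFReal 0 1).intervalIntegrable fun y hy =>
          le_gaussianPDFReal_std (abs_le.2 ⟨by linarith [hy.1], by linarith [hy.2]⟩)

lemma continuousOn_centralProb : ContinuousOn centralProb (Set.Ici 0) := by
  have hc : Continuous fun x : ℝ => ∫ y in (0 : ℝ)..x, gaussianPDFReal 0 1 y :=
    intervalIntegral.continuous_primitive
      (fun _ _ => (integrable_gaussianPDFReal 0 1).intervalIntegrable) 0
  have : Continuous fun x : ℝ => (∫ y in (0 : ℝ)..x, gaussianPDFReal 0 1 y)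
      - ∫ y in (0 : ℝ)..(-x), gaussianPDFReal 0 1 y := hc.sub (hc.comp continuous_neg)
  refine this.continuousOn.congr fun x hx => ?_
  rw [centralProb_eq_intervalIntegral hx]
  exact (intervalIntegral.integral_interval_sub_left
    (integrable_gaussianPDFReal 0 1).intervalIntegrable
    (integrable_gaussianPDFReal 0 1).intervalIntegrable).symm

lemma gaussianReal_std_tail (x : ℝ) :
    (gaussianReal 0 1).real {y | x ≤ y} ≤ Real.exp (1 / 2 - x) := by
  have h := measure_ge_le_exp_mul_mgf (μ := gaussianReal 0 1) (X := id) (t := 1) x zero_le_one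
    (integrable_exp_mul_gaussianReal 1)
  rw [mgf_id_gaussianReal, ← Real.exp_add] at h
  refine h.trans (Real.exp_le_exp.2 ?_)
  simp

lemma gaussianReal_std_tail_neg (x : ℝ) :
    (gaussianReal 0 1).real {y | y ≤ -x} ≤ Real.exp (1 / 2 - x) := by
  refine le_of_eq_of_le ?_ (gaussianReal_std_tail x)
  have h : (gaussianReal 0 1).map (fun y => -y) = gaussianReal 0 1 := by
    rw [gaussianReal_map_neg, neg_zero]
  rw [← h, map_measureReal_apply (by fun_prop) (measurableSet_le (by fun_prop) (by fun_prop)), h]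
  congr 1
  ext y
  simp

lemma compl_Icc_neg_self (x : ℝ) : (Set.Icc (-x) x)ᶜ = {y | x < |y|} := by
  ext y
  simp only [Set.mem_compl_iff, Set.mem_Icc, ← abs_le, not_le, Set.mem_ofPred_eq]

lemma one_sub_centralProb (x : ℝ) :
    1 - centralProb x = (gaussianReal 0 1).real {y | x < |y|} := by
  rw [← compl_Icc_neg_self, probReal_compl_eq_one_sub measurableSet_Icc, centralProb]

/-- A single exponential rate valid for all `x ≥ 0`, so that products over independent coordinates
become sums of `1 / s i`. Small `x` uses the density bound, `1 < x ≤ 8` monotonicity, and larger `x`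
the Chernoff bound. -/
lemma one_sub_centralProb_le {x : ℝ} (hx : 0 ≤ x) :
    1 - centralProb x ≤ Real.exp (-(x / 30)) := by
  rcases le_or_gt x 1 with h1 | h1
  · linarith [le_centralProb hx h1, Real.add_one_le_exp (-(x / 30))]
  rcases le_or_gt x 8 with h8 | h8
  · linarith [le_centralProb zero_le_one le_rfl, centralProb_mono h1.le,
      Real.add_one_le_exp (-(x / 30))]
  have hsub : {y : ℝ | x < |y|} ⊆ {y | x ≤ y} ∪ {y | y ≤ -x} := by
    intro y hy
    have hy' : x < |y| := hy
    rcases lt_abs.1 hy' with h | h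
    · exact Or.inl h.le
    · exact Or.inr (by simp only [Set.mem_ofPred_eq]; linarith)
  rw [one_sub_centralProb]
  calc _ ≤ _ := measureReal_mono hsub
    _ ≤ Real.exp (1 / 2 - x) + Real.exp (1 / 2 - x) := (measureReal_union_le _ _).trans
        (add_le_add (gaussianReal_std_tail x) (gaussianReal_std_tail_neg x))
    _ ≤ Real.exp 1 * Real.exp (1 / 2 - x) := by
        nlinarith [Real.add_one_le_exp 1, Real.exp_pos (1 / 2 - x)]
    _ ≤ _ := by
        rw [← Real.exp_add]
        exact Real.exp_le_exp.2 (by linarith)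

lemma integrable_sq_gaussianReal_std : Integrable (fun y : ℝ => y ^ 2) (gaussianReal 0 1) :=
  (memLp_id_gaussianReal 2).integrable_sq

lemma integral_sq_gaussianReal_std : ∫ y, y ^ 2 ∂(gaussianReal 0 1) = 1 := by
  have h := variance_fun_id_gaussianReal (μ := 0) (v := 1)
  rwa [variance_of_integral_eq_zero aemeasurable_id' (by simp)] at h

/-- The truncated second moment of the standard Gaussian measure. -/
noncomputable def truncSq (x : ℝ) : ℝ := ∫ y in Set.Icc (-x) x, y ^ 2 ∂(gaussianReal 0 1)

lemma truncSq_mono : Monotone truncSq := fun _ _ h =>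
  setIntegral_mono_set integrable_sq_gaussianReal_std.integrableOn
    (Filter.Eventually.of_forall fun y => sq_nonneg y)
    (Set.Icc_subset_Icc (neg_le_neg h) h).eventuallyLE

lemma le_truncSq {x : ℝ} (hx : 0 ≤ x) (hx1 : x ≤ 1) : x ^ 3 / 9 ≤ truncSq x := by
  have h : truncSq x = ∫ y in -x..x, gaussianPDFReal 0 1 y * y ^ 2 := by
    rw [intervalIntegral.integral_of_le (by linarith), ← integral_Icc_eq_integral_Ioc, truncSq,
      ← integral_indicator measurableSet_Icc, ← integral_indicator measurableSet_Icc,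
      integral_gaussianReal_eq_integral_smul one_ne_zero]
    congr 1 with y
    by_cases hy : y ∈ Set.Icc (-x) x <;> simp [hy]
  have hint : Integrable (fun y => gaussianPDFReal 0 1 y * y ^ 2) := by
    have := integrable_sq_gaussianReal_std
    rw [gaussianReal_of_var_ne_zero 0 one_ne_zero, integrable_withDensity_iff_integrable_smul'
      (measurable_gaussianPDF 0 1) (Filter.Eventually.of_forall fun _ => gaussianPDF_lt_top)] at this
    simpa using this
  rw [h]
  calc x ^ 3 / 9 = ∫ y in -x..x, 1 / 6 * y ^ 2 := by
        rw [intervalIntegral.integral_const_mul, integral_pow]; ring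
    _ ≤ _ := intervalIntegral.integral_mono_on (by linarith)
        (by apply Continuous.intervalIntegrable; fun_prop) hint.intervalIntegrable fun y hy =>
          mul_le_mul_of_nonneg_right
            (le_gaussianPDFReal_std (abs_le.2 ⟨by linarith [hy.1], by linarith [hy.2]⟩))
            (sq_nonneg y)

/-! ### Scaled standard Gaussians -/

/-- The probability that `s` times a standard Gaussian is at most `t` in absolute value. -/
noncomputable def smallProb (s t : ℝ) : ℝ := (gaussianReal 0 1).real {y | |s * y| ≤ t}

/-- The second moment of `s` times a standard Gaussian, truncated at level `t`. -/
noncomputable def truncVar (s t : ℝ) : ℝ :=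
  ∫ y in {y | |s * y| ≤ t}, (s * y) ^ 2 ∂(gaussianReal 0 1)

lemma setOf_abs_mul_le {s : ℝ} (hs : 0 < s) (t : ℝ) :
    {y : ℝ | |s * y| ≤ t} = Set.Icc (-(t / s)) (t / s) := by
  ext y
  rw [Set.mem_Icc, ← abs_le, le_div_iff₀ hs, Set.mem_ofPred_eq, abs_mul, abs_of_pos hs, mul_comm]

lemma measurableSet_abs_mul_le (s t : ℝ) : MeasurableSet {y : ℝ | |s * y| ≤ t} :=
  measurableSet_le (by fun_prop) (by fun_prop)

lemma smallProb_of_pos {s : ℝ} (hs : 0 < s) (t : ℝ) : smallProb s t = centralProb (t / s) := by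
  rw [smallProb, setOf_abs_mul_le hs, centralProb]

lemma smallProb_zero {t : ℝ} (ht : 0 ≤ t) : smallProb 0 t = 1 := by
  simp [smallProb, ht]

lemma smallProb_le_one (s t : ℝ) : smallProb s t ≤ 1 := measureReal_le_one

lemma truncVar_of_pos {s : ℝ} (hs : 0 < s) (t : ℝ) : truncVar s t = s ^ 2 * truncSq (t / s) := by
  rw [truncVar, setOf_abs_mul_le hs, truncSq, ← integral_const_mul]
  simp_rw [mul_pow]

lemma truncVar_nonneg (s t : ℝ) : 0 ≤ truncVar s t := integral_nonneg fun _ => sq_nonneg _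

lemma integrable_sq_mul_gaussianReal_std (s : ℝ) :
    Integrable (fun y : ℝ => (s * y) ^ 2) (gaussianReal 0 1) := by
  simp_rw [mul_pow]
  exact integrable_sq_gaussianReal_std.const_mul _

lemma integral_sq_mul_gaussianReal_std (s : ℝ) :
    ∫ y, (s * y) ^ 2 ∂(gaussianReal 0 1) = s ^ 2 := by
  simp_rw [mul_pow]
  rw [integral_const_mul, integral_sq_gaussianReal_std, mul_one]

lemma integrable_posPart_sub_sq (c s : ℝ) :
    Integrable (fun y : ℝ => max (c - (s * y) ^ 2) 0) (gaussianReal 0 1) :=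
  ((integrable_const c).sub (integrable_sq_mul_gaussianReal_std s)).pos_part

lemma integral_posPart_sub_sq (s : ℝ) {t : ℝ} (ht : 0 ≤ t) :
    ∫ y, max (t ^ 2 - (s * y) ^ 2) 0 ∂(gaussianReal 0 1)
      = t ^ 2 * smallProb s t - truncVar s t := by
  have hm := measurableSet_abs_mul_le s t
  have h : ∀ y, max (t ^ 2 - (s * y) ^ 2) 0
      = {y | |s * y| ≤ t}.indicator (fun y => t ^ 2 - (s * y) ^ 2) y := by
    intro y
    by_cases hy : |s * y| ≤ t
    · rw [Set.indicator_of_mem (by exact hy), max_eq_left]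
      rw [sub_nonneg, ← sq_abs]
      exact pow_le_pow_left₀ (abs_nonneg _) hy 2
    · rw [Set.indicator_of_notMem (by exact hy), max_eq_right]
      rw [sub_nonpos, ← sq_abs (s * y)]
      exact pow_le_pow_left₀ ht (not_le.1 hy).le 2
  simp_rw [h]
  rw [integral_indicator hm, integral_sub (integrable_const _)
    (integrable_sq_mul_gaussianReal_std s).integrableOn, setIntegral_const, smul_eq_mul, mul_comm]
  rfl

/-- Here `t / s ≥ 1 / 2`, and `le_truncSq` at `1 / 2` gives `1 / 72`. -/
lemma sq_le_truncVar {s t : ℝ} (hs : 0 ≤ s) (hst : s ≤ 2 * t) : s ^ 2 ≤ 72 * truncVar s t := by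
  rcases hs.eq_or_lt with rfl | hs
  · have := truncVar_nonneg 0 t
    linarith
  rw [truncVar_of_pos hs]
  have h1 : (1 / 2 : ℝ) ≤ t / s := by rw [le_div_iff₀ hs]; linarith
  have h2 := le_truncSq (x := 1 / 2) (by norm_num) (by norm_num)
  have h3 := truncSq_mono h1
  nlinarith [sq_nonneg s]

lemma mul_le_truncVar {s t : ℝ} (ht : 0 < t) (hst : 2 * t < s) :
    t ^ 2 * (t / s) ≤ 9 * truncVar s t := by
  have hs : 0 < s := by linarith
  rw [truncVar_of_pos hs]
  have h := le_truncSq (x := t / s) (by positivity) (by rw [div_le_one hs]; linarith)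
  have h2 : t ^ 2 * (t / s) = s ^ 2 * (t / s) ^ 3 := by field_simp
  rw [h2]
  nlinarith [sq_nonneg s]

lemma tendsto_centralProb : Filter.Tendsto centralProb Filter.atTop (nhds 1) := by
  have h : Filter.Tendsto (fun x : ℝ => 1 - Real.exp (-(x / 30))) Filter.atTop (nhds (1 - 0)) :=
    tendsto_const_nhds.sub (Real.tendsto_exp_neg_atTop_nhds_zero.comp
      (Filter.tendsto_id.atTop_div_const (by norm_num)))
  rw [sub_zero] at h
  refine tendsto_of_tendsto_of_tendsto_of_le_of_le' h tendsto_const_nhds ?_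
    (Filter.Eventually.of_forall centralProb_le_one)
  filter_upwards [Filter.eventually_ge_atTop 0] with x hx
  linarith [one_sub_centralProb_le hx]

lemma tendsto_smallProb {s : ℝ} (hs : 0 ≤ s) :
    Filter.Tendsto (smallProb s) Filter.atTop (nhds 1) := by
  rcases hs.eq_or_lt with rfl | hs
  · refine tendsto_const_nhds.congr' ?_
    filter_upwards [Filter.eventually_ge_atTop 0] with t ht
    exact (smallProb_zero ht).symm
  · simp_rw [funext fun t => smallProb_of_pos hs t]
    exact tendsto_centralProb.comp (Filter.tendsto_id.atTop_div_const hs)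

lemma continuousOn_smallProb {s : ℝ} (hs : 0 ≤ s) :
    ContinuousOn (smallProb s) (Set.Ici 0) := by
  rcases hs.eq_or_lt with rfl | hs
  · exact continuousOn_const.congr fun t ht => smallProb_zero ht
  · refine (continuousOn_centralProb.comp (f := fun t => t / s) (by fun_prop)
      fun t ht => ?_).congr fun t _ => smallProb_of_pos hs t
    exact div_nonneg ht hs.le

/-- Intermediate value theorem: at `t = 0` only the degenerate coordinates count, and as `t → ∞` the
sum tends to the number of coordinates, which exceeds `k`. -/
lemma exists_sum_smallProb_eq {ι : Type*} [Fintype ι] {k : ℕ} {s : ι → ℝ} (hs : ∀ i, 0 ≤ s i)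
    (hk : k < Fintype.card ι) (hz : (Finset.univ.filter fun i => s i = 0).card < k) :
    ∃ t, 0 < t ∧ ∑ i, smallProb (s i) t = k := by
  have h0 : ∑ i, smallProb (s i) 0 < k := by
    have : ∀ i, smallProb (s i) 0 ≤ if s i = 0 then 1 else 0 := by
      intro i
      split_ifs with h
      · exact smallProb_le_one _ _
      · rw [smallProb_of_pos (lt_of_le_of_ne (hs i) (Ne.symm h)), zero_div]
        exact centralProb_le le_rfl
    refine (Finset.sum_le_sum fun i _ => this i).trans_lt ?_
    rw [Finset.sum_boole]
    exact_mod_cast hz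
  have hlim : Filter.Tendsto (fun t => ∑ i, smallProb (s i) t) Filter.atTop
      (nhds (Fintype.card ι : ℝ)) := by
    have := tendsto_finsetSum Finset.univ fun i _ => tendsto_smallProb (hs i)
    simpa using this
  obtain ⟨b, hb, hb0⟩ := ((hlim.eventually (lt_mem_nhds (by exact_mod_cast hk :
    (k : ℝ) < Fintype.card ι))).and (Filter.eventually_ge_atTop 0)).exists
  have hcont : ContinuousOn (fun t => ∑ i, smallProb (s i) t) (Set.Icc 0 b) :=
    continuousOn_finsetSum _ fun i _ => (continuousOn_smallProb (hs i)).mono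
      Set.Icc_subset_Ici_self
  obtain ⟨t, ht, htk⟩ := intermediate_value_Icc hb0 hcont ⟨h0.le, hb.le⟩
  refine ⟨t, lt_of_le_of_ne ht.1 ?_, htk⟩
  rintro rfl
  exact h0.ne htk

/-! ### Random variables distributed as a scaled standard Gaussian -/

section Law

variable {Ω : Type*} [MeasurableSpace Ω] {P : Measure Ω}

lemma integral_comp_of_hasLaw_scaled {X : Ω → ℝ} {s : ℝ}
    (hX : HasLaw X ((gaussianReal 0 1).map (s * ·)) P) {f : ℝ → ℝ} (hf : Measurable f) :
    ∫ ω, f (X ω) ∂P = ∫ y, f (s * y) ∂(gaussianReal 0 1) := by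
  rw [← integral_map (φ := fun y => s * y) (by fun_prop) hf.aestronglyMeasurable]
  exact hX.integral_comp hf.aestronglyMeasurable

lemma integrable_comp_of_hasLaw_scaled {X : Ω → ℝ} {s : ℝ}
    (hX : HasLaw X ((gaussianReal 0 1).map (s * ·)) P) {f : ℝ → ℝ} (hf : Measurable f)
    (h : Integrable (fun y => f (s * y)) (gaussianReal 0 1)) :
    Integrable (fun ω => f (X ω)) P := by
  have h1 : Integrable f ((gaussianReal 0 1).map (s * ·)) :=
    (integrable_map_measure hf.aestronglyMeasurable (by fun_prop)).2 h
  rw [← hX.map_eq] at h1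
  exact (integrable_map_measure hf.aestronglyMeasurable hX.aemeasurable).1 h1

lemma integrable_sq_of_hasLaw_scaled {X : Ω → ℝ} {s : ℝ}
    (hX : HasLaw X ((gaussianReal 0 1).map (s * ·)) P) : Integrable (fun ω => X ω ^ 2) P :=
  integrable_comp_of_hasLaw_scaled hX (f := fun x => x ^ 2) (by fun_prop)
    (integrable_sq_mul_gaussianReal_std s)

lemma integral_sq_of_hasLaw_scaled {X : Ω → ℝ} {s : ℝ}
    (hX : HasLaw X ((gaussianReal 0 1).map (s * ·)) P) : ∫ ω, X ω ^ 2 ∂P = s ^ 2 := by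
  rw [integral_comp_of_hasLaw_scaled hX (f := fun x => x ^ 2) (by fun_prop),
    integral_sq_mul_gaussianReal_std]

lemma measureReal_lt_sq_le {X : Ω → ℝ} {s u : ℝ} (hs : 0 < s) (hu : 0 ≤ u)
    (hX : HasLaw X ((gaussianReal 0 1).map (s * ·)) P) :
    P.real (X ⁻¹' {x | u < x ^ 2}) ≤ Real.exp (-(√u / (30 * s))) := by
  have hm : MeasurableSet {x : ℝ | u < x ^ 2} := measurableSet_lt (by fun_prop) (by fun_prop)
  have h1 : P.real (X ⁻¹' {x | u < x ^ 2}) = 1 - centralProb (√u / s) := by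
    have := hX.measureReal_eq hm
    rw [one_sub_centralProb]
    refine this.trans ?_
    rw [map_measureReal_apply (by fun_prop) hm]
    congr 1
    ext y
    simp only [Set.mem_preimage, Set.mem_ofPred_eq]
    rw [div_lt_iff₀ hs, ← Real.sqrt_lt_sqrt_iff hu, Real.sqrt_sq_eq_abs, abs_mul, abs_of_pos hs,
      mul_comm]
  rw [h1]
  refine (one_sub_centralProb_le (by positivity)).trans_eq ?_
  congr 1
  field_simp

/-- The square of the smallest of independent Gaussians has expectation controlled by the
harmonic sum of the standard deviations. -/
lemma integral_inf'_sq_le [IsProbabilityMeasure P] {ι : Type*} [Finite ι] {X : ι → Ω → ℝ} {s : ι → ℝ}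
    (hX : ∀ i, HasLaw (X i) ((gaussianReal 0 1).map (s i * ·)) P) (hind : iIndepFun X P)
    {S : Finset ι} (hS : S.Nonempty) (hs : ∀ i ∈ S, 0 < s i) {t : ℝ} (ht : 0 < t)
    (hsum : 1 / 2 ≤ ∑ i ∈ S, t / s i) :
    Integrable (fun ω => S.inf' hS (fun i => X i ω ^ 2)) P ∧
    ∫ ω, S.inf' hS (fun i => X i ω ^ 2) ∂P ≤ 7200 * t ^ 2 := by
  have hint : Integrable (fun ω => S.inf' hS (fun i => X i ω ^ 2)) P := by
    obtain ⟨i₀, hi₀⟩ := id hS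
    refine (integrable_sq_of_hasLaw_scaled (hX i₀)).mono' ?_
      (Filter.Eventually.of_forall fun ω => ?_)
    · refine AEMeasurable.aestronglyMeasurable ?_
      have hc : Continuous fun x : ι → ℝ => S.inf' hS fun i => x i ^ 2 :=
        Continuous.finset_inf'_apply _ fun i _ => by fun_prop
      exact hc.measurable.comp_aemeasurable (aemeasurable_pi_lambda _ fun i => (hX i).aemeasurable)
    · rw [Real.norm_of_nonneg (Finset.le_inf' _ _ fun i _ => sq_nonneg _)]
      exact Finset.inf'_le _ hi₀
  refine ⟨hint, ?_⟩
  rw [hint.integral_eq_integral_meas_lt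
    (Filter.Eventually.of_forall fun ω => Finset.le_inf' _ _ fun i _ => sq_nonneg _)]
  have hb : (0 : ℝ) < 1 / (60 * t) := by positivity
  -- Independence turns the tail of the minimum into a product of exponentials, whose total rate is
  -- at least `√u / (60 * t)` by `hsum`.
  have hbound : ∀ u ∈ Set.Ioi (0 : ℝ), P.real {ω | u < S.inf' hS (fun i => X i ω ^ 2)}
      ≤ Real.exp (-(1 / (60 * t)) * u ^ (1 / 2 : ℝ)) := by
    intro u hu
    have hset : {ω | u < S.inf' hS (fun i => X i ω ^ 2)}
        = ⋂ i ∈ S, X i ⁻¹' {x | u < x ^ 2} := by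
      ext ω
      simp [Finset.lt_inf'_iff]
    have hprod := (iIndepFun_iff_measure_inter_preimage_eq_mul.1 hind) S
      (sets := fun _ => {x | u < x ^ 2})
      fun _ _ => measurableSet_lt (by fun_prop) (by fun_prop)
    rw [hset, measureReal_def, hprod, ENNReal.toReal_prod]
    calc ∏ i ∈ S, (P (X i ⁻¹' {x | u < x ^ 2})).toReal
        ≤ ∏ i ∈ S, Real.exp (-(√u / (30 * s i))) :=
          Finset.prod_le_prod (fun _ _ => ENNReal.toReal_nonneg)
            fun i hi => measureReal_lt_sq_le (hs i hi) (le_of_lt hu) (hX i)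
      _ = Real.exp (-(√u / (30 * t) * ∑ i ∈ S, t / s i)) := by
          rw [← Real.exp_sum, Finset.sum_neg_distrib, Finset.mul_sum]
          congr 2
          refine Finset.sum_congr rfl fun i hi => ?_
          have := (hs i hi).ne'
          field_simp
      _ ≤ _ := by
          refine Real.exp_le_exp.2 ?_
          rw [← Real.sqrt_eq_rpow]
          have h2 : √u / (30 * t) * (1 / 2) ≤ √u / (30 * t) * ∑ i ∈ S, t / s i :=
            mul_le_mul_of_nonneg_left hsum (by positivity)
          have h3 : √u / (30 * t) * (1 / 2) = 1 / (60 * t) * √u := by field_simp; ring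
          linarith
  have hval := integral_exp_neg_mul_rpow (p := 1 / 2) (b := 1 / (60 * t)) (by norm_num) hb
  have hexp : IntegrableOn (fun u : ℝ => Real.exp (-(1 / (60 * t)) * u ^ (1 / 2 : ℝ)))
      (Set.Ioi 0) := by
    -- A non-integrable function has integral `0` by convention, against the positive closed form.
    by_contra hn
    rw [integral_undef hn] at hval
    have : 0 < (1 / (60 * t)) ^ (-1 / (1 / 2) : ℝ) * Real.Gamma (1 / (1 / 2) + 1) :=
      mul_pos (Real.rpow_pos_of_pos hb _) (Real.Gamma_pos_of_pos (by norm_num))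
    linarith
  calc _ ≤ ∫ u in Set.Ioi (0 : ℝ), Real.exp (-(1 / (60 * t)) * u ^ (1 / 2 : ℝ)) := by
        refine integral_mono_of_nonneg (Filter.Eventually.of_forall fun _ => measureReal_nonneg)
          hexp ?_
        exact (ae_restrict_iff' measurableSet_Ioi).2 (Filter.Eventually.of_forall hbound)
    -- The value is `b ^ (-2) * Γ(3)` with `b = 1 / (60 * t)`, that is `2 * 3600 * t ^ 2`.
    _ = 7200 * t ^ 2 := by
        rw [hval, show (-1 / (1 / 2) : ℝ) = -((2 : ℕ) : ℝ) by norm_num, Real.rpow_neg hb.le,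
          Real.rpow_natCast, show (1 / (1 / 2) + 1 : ℝ) = ((2 : ℕ) : ℝ) + 1 by norm_num,
          Real.Gamma_nat_eq_factorial]
        simp [Nat.factorial]
        field_simp
        norm_num

end Law

/-! ### The upper bound for independent coordinates -/

lemma exists_subset_half_le_sum_le_one {ι : Type*} [DecidableEq ι] {x : ι → ℝ} (J : Finset ι)
    (hx : ∀ i ∈ J, x i ≤ 1 / 2) (hJ : 1 / 2 ≤ ∑ i ∈ J, x i) :
    ∃ S ⊆ J, 1 / 2 ≤ ∑ i ∈ S, x i ∧ ∑ i ∈ S, x i ≤ 1 := by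
  induction J using Finset.induction_on with
  | empty => norm_num at hJ
  | insert a J ha ih =>
    by_cases h : 1 / 2 ≤ ∑ i ∈ J, x i
    · obtain ⟨S, hSJ, hS⟩ := ih (fun i hi => hx i (Finset.mem_insert_of_mem hi)) h
      exact ⟨S, hSJ.trans (Finset.subset_insert _ _), hS⟩
    · refine ⟨insert a J, subset_rfl, hJ, ?_⟩
      rw [Finset.sum_insert ha]
      linarith [hx a (Finset.mem_insert_self _ _)]

section Independent

variable {Ω : Type*} [MeasurableSpace Ω] {P : Measure Ω}

/-- Blocks are peeled off one at a time: mass at least `1 / 2` controls the block's minimum, mass at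
most `1` leaves enough for the remaining blocks. `W` is the sum of the block minima; `K`, their
locations, may depend on `ω`, and no measurable selection is needed. -/
lemma exists_dominating_smallest_sum [IsProbabilityMeasure P] {ι : Type*} [Finite ι] [DecidableEq ι]
    {X : ι → Ω → ℝ} {s : ι → ℝ} (hX : ∀ i, HasLaw (X i) ((gaussianReal 0 1).map (s i * ·)) P)
    (hind : iIndepFun X P) {t : ℝ} (ht : 0 < t) (l : ℕ) (J : Finset ι)
    (hs : ∀ i ∈ J, 2 * t < s i) (hJ : (l : ℝ) ≤ ∑ i ∈ J, t / s i) :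
    ∃ W : Ω → ℝ, Integrable W P ∧ ∫ ω, W ω ∂P ≤ l * (7200 * t ^ 2) ∧
      ∀ ω, ∃ K ⊆ J, K.card = l ∧ ∑ i ∈ K, X i ω ^ 2 ≤ W ω := by
  induction l generalizing J with
  | zero => exact ⟨fun _ => 0, integrable_zero _ _ _, by simp, fun ω => ⟨∅, by simp⟩⟩
  | succ l ih =>
    push_cast at hJ
    obtain ⟨S, hSJ, hS1, hS2⟩ := exists_subset_half_le_sum_le_one (x := fun i => t / s i) J
      (fun i hi => by
        have := hs i hi
        rw [div_le_iff₀ (by linarith)]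
        linarith)
      (by linarith [Nat.cast_nonneg (α := ℝ) l])
    have hSne : S.Nonempty := by
      rw [Finset.nonempty_iff_ne_empty]
      rintro rfl
      norm_num at hS1
    obtain ⟨W, hW, hWint, hWK⟩ := ih (J \ S) (fun i hi => hs i (Finset.sdiff_subset hi)) (by
      have := Finset.sum_sdiff (f := fun i => t / s i) hSJ
      linarith)
    obtain ⟨hm, hmint⟩ := integral_inf'_sq_le hX hind hSne
      (fun i hi => by linarith [hs i (hSJ hi)]) ht hS1
    refine ⟨fun ω => W ω + S.inf' hSne (fun i => X i ω ^ 2), hW.add hm, ?_, fun ω => ?_⟩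
    · rw [integral_add hW hm]
      push_cast
      linarith
    · obtain ⟨K, hKJ, hK, hKW⟩ := hWK ω
      obtain ⟨i, hi, hinf⟩ := Finset.exists_mem_eq_inf' hSne (fun i => X i ω ^ 2)
      have hiK : i ∉ K := fun h => (Finset.mem_sdiff.1 (hKJ h)).2 hi
      refine ⟨insert i K, Finset.insert_subset (hSJ hi) (hKJ.trans Finset.sdiff_subset), ?_, ?_⟩
      · rw [Finset.card_insert_of_notMem hiK, hK]
      · rw [Finset.sum_insert hiK]
        linarith

variable {n k : ℕ} {X : Fin n → Ω → ℝ} {s : Fin n → ℝ}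

lemma integral_sumJMin_le_sum (hX : ∀ i, HasLaw (X i) ((gaussianReal 0 1).map (s i * ·)) P)
    (K : Finset (Fin n)) :
    ∫ ω, sumJMin K.card (fun i => X i ω ^ 2) ∂P ≤ ∑ i ∈ K, s i ^ 2 := by
  have hkn : K.card ≤ n := by simpa using K.card_le_univ
  have hint i := integrable_sq_of_hasLaw_scaled (hX i)
  calc _ ≤ ∫ ω, ∑ i ∈ K, X i ω ^ 2 ∂P :=
        integral_mono (integrable_sumJMin hkn (fun _ _ => sq_nonneg _) hint)
          (integrable_finsetSum _ fun i _ => hint i) fun ω => sumJMin_le_sum _ K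
    _ = _ := by
        rw [integral_finsetSum _ fun i _ => hint i]
        exact Finset.sum_congr rfl fun i _ => integral_sq_of_hasLaw_scaled (hX i)

lemma integral_sumJMin_le_truncVar [IsProbabilityMeasure P]
    (hX : ∀ i, HasLaw (X i) ((gaussianReal 0 1).map (s i * ·)) P) (hs : ∀ i, 0 ≤ s i)
    (hind : iIndepFun X P) (hkn : k ≤ n) {t : ℝ} (ht : 0 < t)
    (htk : ∑ i, smallProb (s i) t = k) :
    ∫ ω, sumJMin k (fun i => X i ω ^ 2) ∂P ≤ 64800 * ∑ i, truncVar (s i) t := by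
  classical
  have hint i := integrable_sq_of_hasLaw_scaled (hX i)
  set I := Finset.univ.filter fun i => s i ≤ 2 * t with hI
  set J := Finset.univ.filter fun i => ¬ s i ≤ 2 * t with hJ
  have hIJ (f : Fin n → ℝ) : ∑ i ∈ I, f i + ∑ i ∈ J, f i = ∑ i, f i :=
    Finset.sum_filter_add_sum_filter_not _ _ _
  have hsI : ∑ i ∈ I, s i ^ 2 ≤ 72 * ∑ i ∈ I, truncVar (s i) t := by
    rw [Finset.mul_sum]
    exact Finset.sum_le_sum fun i hi => sq_le_truncVar (hs i) (Finset.mem_filter.1 hi).2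
  have hFI : 0 ≤ ∑ i ∈ I, truncVar (s i) t := Finset.sum_nonneg fun i _ => truncVar_nonneg _ _
  have hFJ : 0 ≤ ∑ i ∈ J, truncVar (s i) t := Finset.sum_nonneg fun i _ => truncVar_nonneg _ _
  have hsJ : ∀ i ∈ J, 2 * t < s i := fun i hi => not_le.1 (Finset.mem_filter.1 hi).2
  rw [← hIJ fun i => truncVar (s i) t]
  rcases le_or_gt k I.card with hk | hk
  · obtain ⟨K, hKI, rfl⟩ := Finset.exists_subset_card_eq hk
    have h1 := integral_sumJMin_le_sum hX K
    have h2 : ∑ i ∈ K, s i ^ 2 ≤ ∑ i ∈ I, s i ^ 2 :=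
      Finset.sum_le_sum_of_subset_of_nonneg hKI fun _ _ _ => sq_nonneg _
    linarith
  · have hpI : ∑ i ∈ I, smallProb (s i) t ≤ I.card := by
      have := Finset.sum_le_card_nsmul I (fun i => smallProb (s i) t) 1
        fun i _ => smallProb_le_one _ _
      simpa using this
    have hpJ : ∑ i ∈ J, smallProb (s i) t ≤ ∑ i ∈ J, t / s i := by
      refine Finset.sum_le_sum fun i hi => ?_
      have h : 0 < s i := by linarith [hsJ i hi]
      rw [smallProb_of_pos h]
      exact centralProb_le (by positivity)
    -- The small coordinates contribute at most `I.card` to the total probability `k`, so `J`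
    -- carries the deficit.
    have hl : ((k - I.card : ℕ) : ℝ) ≤ ∑ i ∈ J, t / s i := by
      rw [Nat.cast_sub hk.le]
      linarith [hIJ fun i => smallProb (s i) t]
    obtain ⟨W, hW, hWint, hWK⟩ := exists_dominating_smallest_sum hX hind ht _ J hsJ hl
    have hFJ' : t ^ 2 * ∑ i ∈ J, t / s i ≤ 9 * ∑ i ∈ J, truncVar (s i) t := by
      rw [Finset.mul_sum, Finset.mul_sum]
      exact Finset.sum_le_sum fun i hi => mul_le_truncVar ht (hsJ i hi)
    have hbound : ∀ ω, sumJMin k (fun i => X i ω ^ 2) ≤ ∑ i ∈ I, X i ω ^ 2 + W ω := by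
      intro ω
      obtain ⟨K, hKJ, hK, hKW⟩ := hWK ω
      have hd : Disjoint I K := (Finset.disjoint_filter_filter_not _ _ _).mono_right hKJ
      have h := sumJMin_le_sum (fun i => X i ω ^ 2) (I ∪ K)
      rw [Finset.card_union_of_disjoint hd, Finset.sum_union hd, hK,
        Nat.add_sub_cancel' hk.le] at h
      linarith
    have hIint : Integrable (fun ω => ∑ i ∈ I, X i ω ^ 2) P :=
      integrable_finsetSum _ fun i _ => hint i
    have h1 : ∫ ω, sumJMin k (fun i => X i ω ^ 2) ∂P ≤ ∑ i ∈ I, s i ^ 2 + ∫ ω, W ω ∂P := by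
      calc _ ≤ ∫ ω, (∑ i ∈ I, X i ω ^ 2 + W ω) ∂P :=
            integral_mono (integrable_sumJMin hkn (fun _ _ => sq_nonneg _) hint)
              (hIint.add hW) hbound
        _ = _ := by
            rw [integral_add hIint hW, integral_finsetSum _ fun i _ => hint i]
            congr 1
            exact Finset.sum_congr rfl fun i _ => integral_sq_of_hasLaw_scaled (hX i)
    -- `64800 = 7200 * 9`, the block bound times the constant of `mul_le_truncVar`.
    have h2 : ((k - I.card : ℕ) : ℝ) * (7200 * t ^ 2) ≤ 64800 * ∑ i ∈ J, truncVar (s i) t := by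
      have := mul_le_mul_of_nonneg_right hl (by positivity : (0 : ℝ) ≤ 7200 * t ^ 2)
      nlinarith
    linarith

end Independent

/-! ### The lower bound through marginals -/

lemma posPart_sub_sum_mul_le {ι : Type*} [Fintype ι] {w : ι → ℝ} (hw : ∀ j, 0 ≤ w j)
    (hw1 : ∑ j, w j = 1) (c : ℝ) (a : ι → ℝ) :
    max (c - ∑ j, w j * a j) 0 ≤ ∑ j, w j * max (c - a j) 0 := by
  refine max_le ?_ (Finset.sum_nonneg fun j _ => mul_nonneg (hw j) (le_max_right _ _))
  calc c - ∑ j, w j * a j = ∑ j, w j * (c - a j) := by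
        simp_rw [mul_sub]
        rw [Finset.sum_sub_distrib, ← Finset.sum_mul, hw1, one_mul]
    _ ≤ _ := Finset.sum_le_sum fun j _ => mul_le_mul_of_nonneg_left (le_max_left _ _) (hw j)

/-- Replacing variances by their averages under a doubly stochastic matrix decreases the sum of
the expectations of a convex function of the squares. -/
lemma sum_integral_posPart_le {ι : Type*} [Fintype ι] {w : ι → ι → ℝ} (hw : ∀ i j, 0 ≤ w i j)
    (hrow : ∀ i, ∑ j, w i j = 1) (hcol : ∀ j, ∑ i, w i j = 1) {s r : ι → ℝ}
    (hr : ∀ i, r i ^ 2 = ∑ j, w i j * s j ^ 2) (c : ℝ) :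
    ∑ i, ∫ y, max (c - (r i * y) ^ 2) 0 ∂(gaussianReal 0 1)
      ≤ ∑ j, ∫ y, max (c - (s j * y) ^ 2) 0 ∂(gaussianReal 0 1) := by
  have h (i : ι) : ∫ y, max (c - (r i * y) ^ 2) 0 ∂(gaussianReal 0 1)
      ≤ ∑ j, w i j * ∫ y, max (c - (s j * y) ^ 2) 0 ∂(gaussianReal 0 1) := by
    simp_rw [← integral_const_mul]
    rw [← integral_finsetSum _ fun j _ => (integrable_posPart_sub_sq c (s j)).const_mul _]
    refine integral_mono (integrable_posPart_sub_sq c (r i))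
      (integrable_finsetSum _ fun j _ => (integrable_posPart_sub_sq c (s j)).const_mul _)
      fun y => ?_
    have hy : (r i * y) ^ 2 = ∑ j, w i j * (s j * y) ^ 2 := by
      rw [mul_pow, hr, Finset.sum_mul]
      exact Finset.sum_congr rfl fun j _ => by ring
    simp only [hy]
    exact posPart_sub_sum_mul_le (hw i) (hrow i) c _
  refine (Finset.sum_le_sum fun i _ => h i).trans_eq ?_
  rw [Finset.sum_comm]
  exact Finset.sum_congr rfl fun j _ => by rw [← Finset.sum_mul, hcol, one_mul]

lemma le_integral_sumJMin {Ω : Type*} [MeasurableSpace Ω] {P : Measure Ω} [IsProbabilityMeasure P]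
    {n k : ℕ} (hkn : k ≤ n) {Y : Fin n → Ω → ℝ} {r : Fin n → ℝ}
    (hY : ∀ i, HasLaw (Y i) ((gaussianReal 0 1).map (r i * ·)) P) (c : ℝ) :
    k * c - ∑ i, ∫ y, max (c - (r i * y) ^ 2) 0 ∂(gaussianReal 0 1)
      ≤ ∫ ω, sumJMin k (fun i => Y i ω ^ 2) ∂P := by
  have hm : Measurable fun x : ℝ => max (c - x ^ 2) 0 := by fun_prop
  have hint i : Integrable (fun ω => max (c - Y i ω ^ 2) 0) P :=
    integrable_comp_of_hasLaw_scaled (hY i) hm (integrable_posPart_sub_sq c (r i))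
  have hsum : Integrable (fun ω => ∑ i, max (c - Y i ω ^ 2) 0) P :=
    integrable_finsetSum _ fun i _ => hint i
  calc _ = ∫ ω, (k * c - ∑ i, max (c - Y i ω ^ 2) 0) ∂P := by
        rw [integral_sub (integrable_const _) hsum, integral_finsetSum _ fun i _ => hint i]
        simp only [integral_const, probReal_univ, one_smul]
        congr 1
        exact Finset.sum_congr rfl fun i _ => (integral_comp_of_hasLaw_scaled (hY i) hm).symm
    _ ≤ _ := integral_mono ((integrable_const _).sub hsum)
        (integrable_sumJMin hkn (fun _ _ => sq_nonneg _) fun i =>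
          integrable_sq_of_hasLaw_scaled (hY i)) fun ω => le_sumJMin hkn _ c

lemma integral_sumJMin_le_of_doublyStochastic {Ω : Type*} [MeasurableSpace Ω] {P : Measure Ω}
    [IsProbabilityMeasure P] {n k : ℕ} (hkn : k < n) {X Y : Fin n → Ω → ℝ} {s r : Fin n → ℝ}
    (hs : ∀ i, 0 ≤ s i)
    (hX : ∀ i, HasLaw (X i) ((gaussianReal 0 1).map (s i * ·)) P)
    (hY : ∀ i, HasLaw (Y i) ((gaussianReal 0 1).map (r i * ·)) P) (hind : iIndepFun X P)
    {w : Fin n → Fin n → ℝ} (hw : ∀ i j, 0 ≤ w i j)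
    (hrow : ∀ i, ∑ j, w i j = 1) (hcol : ∀ j, ∑ i, w i j = 1)
    (hr : ∀ i, r i ^ 2 = ∑ j, w i j * s j ^ 2) :
    ∫ ω, sumJMin k (fun i => X i ω ^ 2) ∂P
      ≤ 64800 * ∫ ω, sumJMin k (fun i => Y i ω ^ 2) ∂P := by
  rcases le_or_gt k (Finset.univ.filter fun i => s i = 0).card with hz | hz
  -- With at least `k` degenerate coordinates the left side vanishes; otherwise a positive level `t`
  -- exists.
  · obtain ⟨K, hK, rfl⟩ := Finset.exists_subset_card_eq hz
    have h1 := integral_sumJMin_le_sum hX K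
    have h2 : ∑ i ∈ K, s i ^ 2 = 0 :=
      Finset.sum_eq_zero fun i hi => by simp [(Finset.mem_filter.1 (hK hi)).2]
    have h3 : 0 ≤ ∫ ω, sumJMin K.card (fun i => Y i ω ^ 2) ∂P :=
      integral_nonneg fun ω => sumJMin_nonneg _ fun _ => sq_nonneg _
    linarith
  · obtain ⟨t, ht, htk⟩ := exists_sum_smallProb_eq hs (by simpa using hkn) hz
    refine (integral_sumJMin_le_truncVar hX hs hind hkn.le ht htk).trans
      (mul_le_mul_of_nonneg_left ?_ (by norm_num))
    refine le_trans ?_ (le_integral_sumJMin hkn.le hY (t ^ 2))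
    have h1 := sum_integral_posPart_le hw hrow hcol hr (t ^ 2)
    simp_rw [integral_posPart_sub_sq _ ht.le] at h1
    -- The choice of `t` makes `t ^ 2 * k` cancel, leaving only truncated variances.
    rw [Finset.sum_sub_distrib (f := fun j => t ^ 2 * smallProb (s j) t), ← Finset.mul_sum,
      htk] at h1
    simp_rw [integral_posPart_sub_sq _ ht.le]
    linarith

/-! ### Gaussian marginals and orthogonal maps -/

lemma hasLaw_scaled_of_hasGaussianLaw {Ω : Type*} [MeasurableSpace Ω] {P : Measure Ω}
    {X : Ω → ℝ} (hX : HasGaussianLaw X P) (h0 : ∫ ω, X ω ∂P = 0) :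
    HasLaw X ((gaussianReal 0 1).map (√Var[X; P] * ·)) P where
  aemeasurable := hX.aemeasurable
  map_eq := by
    rw [hX.map_eq_gaussianReal, h0, gaussianReal_map_const_mul, mul_zero, mul_one]
    congr 1
    ext
    simp [Real.sq_sqrt (variance_nonneg X P), variance_nonneg]

section Orthogonal

variable {n : ℕ} (T : EuclideanSpace ℝ (Fin n) ≃ₗᵢ[ℝ] EuclideanSpace ℝ (Fin n))

lemma apply_eq_sum_single (x : EuclideanSpace ℝ (Fin n)) (i : Fin n) :
    T x i = ∑ j, T (EuclideanSpace.single j 1) i * x j := by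
  have hx : x = ∑ j, x j • EuclideanSpace.single j (1 : ℝ) := by
    ext i
    simp [Finset.sum_apply, Pi.single_apply]
  conv_lhs => rw [hx]
  simp [mul_comm]

lemma sum_sq_apply_single_col (j : Fin n) :
    ∑ i, T (EuclideanSpace.single j 1) i ^ 2 = 1 := by
  have h := EuclideanSpace.real_norm_sq_eq (T (EuclideanSpace.single j 1))
  rw [← h, T.norm_map]
  simp

/-- The adjoint of an isometry is its inverse; this transfers the column identity to rows. -/
lemma apply_single_eq_symm (i j : Fin n) :
    T (EuclideanSpace.single j 1) i = T.symm (EuclideanSpace.single i 1) j := by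
  have h := T.inner_map_eq_flip (EuclideanSpace.single j 1) (EuclideanSpace.single i 1)
  rw [EuclideanSpace.inner_single_right, EuclideanSpace.inner_single_left] at h
  simpa using h

lemma sum_sq_apply_single_row (i : Fin n) :
    ∑ j, T (EuclideanSpace.single j 1) i ^ 2 = 1 := by
  simp_rw [apply_single_eq_symm T i]
  exact sum_sq_apply_single_col T.symm i

end Orthogonal

theorem mainTheorem1 :
    ∃ C : ℝ, 0 < C ∧
      ∀ (n k : ℕ), 1 ≤ k → k < n →
      ∀ (Ω : Type*) [MeasurableSpace Ω] (P : Measure Ω) [IsProbabilityMeasure P]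
        (X : Ω → EuclideanSpace ℝ (Fin n)),
        HasGaussianLaw X P →
        (∀ i, ∫ ω, X ω i ∂P = 0) →
        iIndepFun (fun i ω => X ω i) P →
      ∀ (T : EuclideanSpace ℝ (Fin n) ≃ₗᵢ[ℝ] EuclideanSpace ℝ (Fin n)),
        Integrable (fun ω => sumJMin k (fun i => (X ω i) ^ 2)) P ∧
        Integrable (fun ω => sumJMin k (fun i => (T (X ω) i) ^ 2)) P ∧
        (∫ ω, sumJMin k (fun i => (X ω i) ^ 2) ∂P)
          ≤ C * (∫ ω, sumJMin k (fun i => (T (X ω) i) ^ 2) ∂P) := by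
  refine ⟨64800, by norm_num, fun n k _ hkn Ω _ P _ X hX h0 hind T => ?_⟩
  have hGX i : HasGaussianLaw (fun ω => X ω i) P := hX.map_fun (EuclideanSpace.proj i)
  have hGY i : HasGaussianLaw (fun ω => T (X ω) i) P :=
    (hX.map_equiv_fun T.toContinuousLinearEquiv).map_fun (EuclideanSpace.proj i)
  have hTX i : (fun ω => T (X ω) i)
      = ∑ j, fun ω => T (EuclideanSpace.single j 1) i * X ω j := by
    ext ω
    rw [Finset.sum_apply]
    exact apply_eq_sum_single T (X ω) i
  have hY0 i : ∫ ω, T (X ω) i ∂P = 0 := by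
    rw [integral_congr_ae (Filter.Eventually.of_forall fun ω => apply_eq_sum_single T (X ω) i)]
    rw [integral_finsetSum _ fun j _ => (hGX j).integrable.const_mul _]
    simp [integral_const_mul, h0]
  have hlX i := hasLaw_scaled_of_hasGaussianLaw (hGX i) (h0 i)
  have hlY i := hasLaw_scaled_of_hasGaussianLaw (hGY i) (hY0 i)
  -- Independence removes the covariances, leaving the doubly stochastic weights.
  have hvar i : Var[fun ω => T (X ω) i; P]
      = ∑ j, T (EuclideanSpace.single j 1) i ^ 2 * Var[fun ω => X ω j; P] := by
    rw [hTX, IndepFun.variance_sum (fun j _ => (hGX j).memLp_two.const_mul _)]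
    · exact Finset.sum_congr rfl fun j _ => variance_const_mul _ _ _
    · intro a _ b _ hab
      exact (hind.indepFun hab).comp (measurable_const_mul _) (measurable_const_mul _)
  refine ⟨integrable_sumJMin hkn.le (fun _ _ => sq_nonneg _) fun i =>
      integrable_sq_of_hasLaw_scaled (hlX i),
    integrable_sumJMin hkn.le (fun _ _ => sq_nonneg _) fun i =>
      integrable_sq_of_hasLaw_scaled (hlY i), ?_⟩
  refine integral_sumJMin_le_of_doublyStochastic hkn (fun i => Real.sqrt_nonneg _) hlX hlY hind
    (w := fun i j => T (EuclideanSpace.single j 1) i ^ 2) (fun _ _ => sq_nonneg _)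
    (sum_sq_apply_single_row T) (sum_sq_apply_single_col T) fun i => ?_
  simp_rw [Real.sq_sqrt (variance_nonneg _ P)]
  exact hvar i
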